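/- Let $\mathbb{K}$ be $\mathbb{R}$ or $\mathbb{C}$. For $0\le m\le n$ and $\mu\in\mathbb{K}^n$ let $\mathfrak{Q}_{n-m,m}(\mu_1,\dots,\mu_n)(\mathbb{K})$ be the quotient of the free Lie algebra over $\mathbb{K}$ on $x_1,\dots,x_n$ by the ideal generated by the relations $$\sum_{i=1}^{n-m}[x_i,[x_i,x_j]]-\sum_{i=n-m+1}^{n}[x_i,[x_i,x_j]]=\mu_jx_j,\qquad j=1,\dots,n.$$ Let $A=(a_{ij})$ be the Cartan matrix of type $E_{10}$, with simple roots labelled so that $\alpha_1,\dots,\alpha_9$ form, in this order, a chain of type $A_9$ in the Dynkin diagram and $\alpha_{10}$ is joined to $\alpha_7$ only. Let $\mathfrak{g}(E_{10})(\mathbb{K})$ be the Kac-Moody algebra of $A$, i.e. the Lie algebra over $\mathbb{K}$ on generators $e_i,h_i,f_i$ ($1\le i\le 10$) with relations $[h_i,e_j]=a_{ij}e_j$, $[h_i,f_j]=-a_{ij}f_j$, $[h_i,h_j]=0$, $[e_i,f_j]=\delta_{ij}h_i$, and, for $i\ne j$, $\operatorname{ad}(e_i)^{1-a_{ij}}(e_j)=0=\operatorname{ad}(f_i)^{1-a_{ij}}(f_j)$.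 For $\delta=\sum_jk_j\alpha_j$ with $k_j\in\mathbb{Z}$ put $\mathfrak{g}_\delta=\{x : [h_i,x]=(\sum_ja_{ij}k_j)\,x \text{ for all } i\}$. Set $\beta=\alpha_7+\alpha_{10}$ and let $$\Gamma=\{\alpha_i+\alpha_{i+1} : 1\le i\le 8\}\cup\{\alpha_i+\alpha_{i+1}+\alpha_{i+2} : 1\le i\le 7\}$$ be the set of the 15 positive roots of height 2 and 3 of the $A_9$-subsystem. Then $\mathfrak{g}_\delta\neq0$ for all $\delta\in\{\beta\}\cup\Gamma$. Moreover, for every choice of non-zero elements $e_\delta\in\mathfrak{g}_\delta$ ($\delta\in\{\beta\}\cup\Gamma$), the 26 elements $f_1,\dots,f_{10}$, $e_\beta$, $e_\gamma$ ($\gamma\in\Gamma$) have the following properties: 1. they generate the Lie algebra $\mathfrak{g}(E_{10})(\mathbb{K})$; 2. $\operatorname{ad}(x)^2(y)=0$ for all $x,y$ among them; 3. they are linearly independent over $\mathbb{K}$; 4. for every $0\le m\le 26$ there is an epimorphism of Lie algebras $\mathfrak{Q}_{26-m,m}(0,\dots,0)(\mathbb{K})\twoheadrightarrow\mathfrak{g}(E_{10})(\mathbb{K})$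 which sends the generators $x_1,\dots,x_{26}$ to these 26 elements, in the order listed ($x_i\mapsto f_i$ for $i\le 10$, $x_{11}\mapsto e_\beta$, then the $e_\gamma$ of height 2 and of height 3, each by increasing $i$). In particular the images of the generators are linearly independent. -/

import Mathlib

/-! ### Quantum minimal surface algebras -/

/-- The `j`-th relator
`∑_{i ≤ n-m} [x_i,[x_i,x_j]] - ∑_{i > n-m} [x_i,[x_i,x_j]] - μ_j x_j`
of the quantum minimal surface algebra of signature `(n-m, m)` and spectrum `μ`.
The index `i : Fin n` counts from `0`, so `i + m < n` singles out the first `n - m` generators. -/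
noncomputable def QMSA.relator (K : Type*) [Field K] (n m : ℕ) (μ : Fin n → K) (j : Fin n) :
    FreeLieAlgebra K (Fin n) :=
  (∑ i : Fin n, (if (i : ℕ) + m < n then (1 : K) else -1) •
      ⁅FreeLieAlgebra.of K i, ⁅FreeLieAlgebra.of K i, FreeLieAlgebra.of K j⁆⁆)
    - μ j • FreeLieAlgebra.of K j

/-- The ideal of the free Lie algebra generated by the relators. -/
noncomputable def QMSA.ideal (K : Type*) [Field K] (n m : ℕ) (μ : Fin n → K) :
    LieIdeal K (FreeLieAlgebra K (Fin n)) :=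
  LieSubmodule.lieSpan K (FreeLieAlgebra K (Fin n)) (Set.range (QMSA.relator K n m μ))

/-- The quantum minimal surface algebra of rank `n`, signature `(n-m, m)` (for `m ≤ n`) and
spectrum `μ`. -/
abbrev QMSA (K : Type*) [Field K] (n m : ℕ) (μ : Fin n → K) : Type _ :=
  FreeLieAlgebra K (Fin n) ⧸ QMSA.ideal K n m μ

/-- The generators `x_i` of the quantum minimal surface algebra. -/
noncomputable def QMSA.x (K : Type*) [Field K] (n m : ℕ) (μ : Fin n → K) (i : Fin n) :
    QMSA K n m μ :=
  LieSubmodule.Quotient.mk (FreeLieAlgebra.of K i)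

/-! ### Kac-Moody algebras

For an invertible symmetrizable generalized Cartan matrix `A`, the Kac-Moody algebra of `A` is
`Matrix.ToLieAlgebra K A`, the Lie algebra with the Chevalley generators and Serre relations. -/

/-- The quotient map from the free Lie algebra on the Chevalley generators. -/
noncomputable def KacMoody.mk (K : Type*) [Field K] {ι : Type*} [DecidableEq ι]
    (A : Matrix ι ι ℤ) (g : FreeLieAlgebra K (CartanMatrix.Generators ι)) :
    Matrix.ToLieAlgebra K A :=
  LieSubmodule.Quotient.mk (N := CartanMatrix.Relations.toIdeal K A) g

/-- The Chevalley generator `h_i`. -/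
noncomputable def KacMoody.h (K : Type*) [Field K] {ι : Type*} [DecidableEq ι]
    (A : Matrix ι ι ℤ) (i : ι) : Matrix.ToLieAlgebra K A :=
  KacMoody.mk K A (FreeLieAlgebra.of K (CartanMatrix.Generators.H i))

/-- The Chevalley generator `f_i`. -/
noncomputable def KacMoody.f (K : Type*) [Field K] {ι : Type*} [DecidableEq ι]
    (A : Matrix ι ι ℤ) (i : ι) : Matrix.ToLieAlgebra K A :=
  KacMoody.mk K A (FreeLieAlgebra.of K (CartanMatrix.Generators.F i))

/-- For `A` invertible over `ℚ`, the root space of `∑ j, k j • α_j`: the elements `x` with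
`[h, x] = (∑ j, k j • α_j)(h) • x` for all `h` in the Cartan subalgebra, which is spanned by the
`h_i`, where `α_j(h_i) = A i j`. -/
def KacMoody.rootSpace (K : Type*) [Field K] {ι : Type*} [Fintype ι] [DecidableEq ι]
    (A : Matrix ι ι ℤ) (k : ι → ℤ) : Submodule K (Matrix.ToLieAlgebra K A) where
  carrier := {x | ∀ i, ⁅KacMoody.h K A i, x⁆ = ((∑ j, A i j * k j : ℤ) : K) • x}
  add_mem' := by
    intro x y hx hy i
    rw [lie_add, hx i, hy i, smul_add]
  zero_mem' := by
    intro i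
    rw [lie_zero, smul_zero]
  smul_mem' := by
    intro c x hx i
    rw [lie_smul, hx i, smul_comm]

/-- A non-zero element of the root lattice is a root if its root space is non-zero. -/
def KacMoody.IsRoot (K : Type*) [Field K] {ι : Type*} [Fintype ι] [DecidableEq ι]
    (A : Matrix ι ι ℤ) (k : ι → ℤ) : Prop :=
  k ≠ 0 ∧ KacMoody.rootSpace K A k ≠ ⊥

/-! ### The example of type `E₁₀` -/

/-- The Cartan matrix of type `E₁₀`, with the labelling of the Dynkin diagram in which
`α_1 - α_2 - ⋯ - α_9` is a chain and `α_10` is attached to `α_7`.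
(The index `i : Fin 10` stands for `α_{i+1}`.) -/
def E10.cartan : Matrix (Fin 10) (Fin 10) ℤ :=
  !![ 2, -1,  0,  0,  0,  0,  0,  0,  0,  0;
     -1,  2, -1,  0,  0,  0,  0,  0,  0,  0;
      0, -1,  2, -1,  0,  0,  0,  0,  0,  0;
      0,  0, -1,  2, -1,  0,  0,  0,  0,  0;
      0,  0,  0, -1,  2, -1,  0,  0,  0,  0;
      0,  0,  0,  0, -1,  2, -1,  0,  0,  0;
      0,  0,  0,  0,  0, -1,  2, -1,  0, -1;
      0,  0,  0,  0,  0,  0, -1,  2, -1,  0;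
      0,  0,  0,  0,  0,  0,  0, -1,  2,  0;
      0,  0,  0,  0,  0,  0, -1,  0,  0,  2]

/-- The Kac-Moody algebra of type `E₁₀` over `K`. -/
abbrev E10.LieAlg (K : Type*) [Field K] : Type _ := Matrix.ToLieAlgebra K E10.cartan

/-- The simple root `α_{i+1}` (for `i < 10`) as an element of the root lattice. -/
def E10.simpleRoot (i : ℕ) : Fin 10 → ℤ := fun j => if (j : ℕ) = i then 1 else 0

/-- `β = α_7 + α_10`. -/
def E10.beta : Fin 10 → ℤ := E10.simpleRoot 6 + E10.simpleRoot 9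

/-- The 8 roots `α_i + α_{i+1}` of height 2 of the subsystem `A₉` spanned by `α_1, …, α_9`. -/
def E10.gammaTwo (i : Fin 8) : Fin 10 → ℤ := E10.simpleRoot i + E10.simpleRoot (i + 1)

/-- The 7 roots `α_i + α_{i+1} + α_{i+2}` of height 3 of the subsystem `A₉`. -/
def E10.gammaThree (i : Fin 7) : Fin 10 → ℤ :=
  E10.simpleRoot i + E10.simpleRoot (i + 1) + E10.simpleRoot (i + 2)

/-- The 16 roots `β`, `α_i + α_{i+1}` (`1 ≤ i ≤ 8`), `α_i + α_{i+1} + α_{i+2}` (`1 ≤ i ≤ 7`). -/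
def E10.roots : Fin 16 → Fin 10 → ℤ :=
  Fin.cons (α := fun _ => Fin 10 → ℤ) E10.beta
    (Fin.append E10.gammaTwo E10.gammaThree : Fin (8 + 7) → Fin 10 → ℤ)

/-- The 26 elements `f_1, …, f_10, e_0, …, e_15` for a family `e` of 16 elements. -/
noncomputable def E10.chi (K : Type*) [Field K] (e : Fin 16 → E10.LieAlg K) :
    Fin 26 → E10.LieAlg K :=
  (Fin.append (KacMoody.f K E10.cartan) e : Fin (10 + 16) → E10.LieAlg K)

/-!
Let `q` be the quadratic form of the symmetric Cartan matrix `A`, so that `q(α_i) = 2`. Simple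
reflections preserve `q` and, by `𝔰𝔩₂`-theory, the set of weights. A positive weight which is not a
multiple of a simple root either pairs non-positively with all simple roots, and then `q ≤ 0`, or a
simple reflection lowers its height and keeps it positive. Hence `q ≤ 2` for all weights. For `k`
and `l` with `q(k) = q(l) = 2` and `(k, l) ≥ -1` we have `q(2k + l) ≥ 6`, so that `ad(x)² y = 0` for
`x` of weight `k` and `y` of weight `l`.

Each of the 16 roots is a Weyl conjugate of a simple root. Each `α_i` equals `γ - α_j` for a `γ`
among them which pairs positively with `α_j`; then `[f_j, e_γ]` is a non-zero multiple of `e_i`.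
Since `det A ≠ 0`, vectors of distinct weights are linearly independent.

None of this says anything unless `h_i ≠ 0`. In the Lie algebra without Serre relations, the ideal
generated by the Serre elements is spanned by the iterated `ad e`-images of the
`ad(e_i)^{1 - a_{ij}} (e_j)` and the iterated `ad f`-images of their counterparts. On a Verma module
with highest weight vector `v`, the former kill `v` and the latter produce vectors without
`v`-component, whereas `h_i v` is a non-zero multiple of `v`.
-/

namespace KacMoody

section ChevalleyRelations

variable {ι L : Type*} [LieRing L]

/-- Generalized Cartan matrices. -/
structure IsGCM (A : Matrix ι ι ℤ) : Prop where
  diag : ∀ i, A i i = 2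
  nonpos : ∀ {i j}, i ≠ j → A i j ≤ 0
  zero_symm : ∀ {i j}, A i j = 0 → A j i = 0

/-- Families of elements of a Lie ring which satisfy the relations between the Chevalley generators
of a Kac-Moody algebra, apart from the Serre relations. The `h i` have to be non-zero, so that each
`(h i, e i, f i)` is an `𝔰𝔩₂`-triple. -/
structure ChevalleyRelations (A : Matrix ι ι ℤ) (h e f : ι → L) : Prop where
  h_ne_zero : ∀ i, h i ≠ 0
  lie_h_h : ∀ i j, ⁅h i, h j⁆ = 0
  lie_e_f : ∀ i, ⁅e i, f i⁆ = h i
  lie_e_f_of_ne : ∀ {i j}, i ≠ j → ⁅e i, f j⁆ = 0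
  lie_h_e : ∀ i j, ⁅h i, e j⁆ = A i j • e j
  lie_h_f : ∀ i j, ⁅h i, f j⁆ = -(A i j • f j)

namespace ChevalleyRelations

variable {A : Matrix ι ι ℤ} {h e f : ι → L}

lemma symm (H : ChevalleyRelations A h e f) : ChevalleyRelations A (-h) f e where
  h_ne_zero i := neg_ne_zero.mpr (H.h_ne_zero i)
  lie_h_h i j := by simp [H.lie_h_h]
  lie_e_f i := by rw [← lie_skew, H.lie_e_f, Pi.neg_apply]
  lie_e_f_of_ne hij := by rw [← lie_skew, H.lie_e_f_of_ne hij.symm, neg_zero]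
  lie_h_e i j := by simp [H.lie_h_f]
  lie_h_f i j := by simp [H.lie_h_e]

lemma isSl2Triple (H : ChevalleyRelations A h e f) {i : ι} (hi : A i i = 2) :
    IsSl2Triple (h i) (e i) (f i) where
  h_ne_zero := H.h_ne_zero i
  lie_e_f := H.lie_e_f i
  lie_h_e_nsmul := by rw [H.lie_h_e, hi, ofNat_zsmul]
  lie_h_f_nsmul := by rw [H.lie_h_f, hi, ofNat_zsmul]

lemma e_ne_zero (H : ChevalleyRelations A h e f) (i : ι) : e i ≠ 0 := fun h0 =>
  H.h_ne_zero i (by rw [← H.lie_e_f, h0, zero_lie])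

end ChevalleyRelations

variable {K : Type*} [Field K] [LieAlgebra K L]

lemma lie_ad_pow_of_lie_eq_zero {x y : L} (hxy : ⁅x, y⁆ = 0) (n : ℕ) (z : L) :
    ⁅x, (LieAlgebra.ad K L y ^ n) z⁆ = (LieAlgebra.ad K L y ^ n) ⁅x, z⁆ := by
  have hcomm : Commute (LieAlgebra.ad K L x) (LieAlgebra.ad K L y) :=
    LinearMap.ext fun z => by simp [leibniz_lie x y z, hxy]
  exact LinearMap.congr_fun (hcomm.pow_right n) z

lemma lie_ad_pow_of_lie_eq_smul {x y z : L} {a b : K} (hy : ⁅x, y⁆ = b • y) (hz : ⁅x, z⁆ = a • z)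
    (n : ℕ) : ⁅x, (LieAlgebra.ad K L y ^ n) z⁆ = (a + n * b) • (LieAlgebra.ad K L y ^ n) z := by
  induction n with
  | zero => simp [hz]
  | succ n ih =>
    rw [pow_succ', Module.End.mul_apply, LieAlgebra.ad_apply, leibniz_lie, hy, ih, lie_smul,
      smul_lie, ← add_smul]
    push_cast
    congr 1
    ring

/-- The Serre element `ad(e_i)^{1 - a_{ij}} (e_j)`. It vanishes for `i = j`, where the truncation
`(-2).toNat = 0` makes it `[e_i, e_i]`. -/
def serreElement (K : Type*) [Field K] [LieAlgebra K L] (A : Matrix ι ι ℤ) (e : ι → L)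
    (i j : ι) : L :=
  (LieAlgebra.ad K L (e i) ^ ((-A i j).toNat + 1)) (e j)

lemma serreElement_self {A : Matrix ι ι ℤ} (e : ι → L) (i : ι) (hi : A i i = 2) :
    serreElement K A e i i = 0 := by
  simp [serreElement, hi]

namespace ChevalleyRelations

variable {A : Matrix ι ι ℤ} {h e f : ι → L}

lemma lie_h_serreElement (H : ChevalleyRelations A h e f) (i j k : ι) :
    ∃ c : K, ⁅h k, serreElement K A e i j⁆ = c • serreElement K A e i j :=
  ⟨_, lie_ad_pow_of_lie_eq_smul (a := (A k j : K)) (b := (A k i : K))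
    (by rw [H.lie_h_e, Int.cast_smul_eq_zsmul]) (by rw [H.lie_h_e, Int.cast_smul_eq_zsmul]) _⟩

lemma lie_f_serreElement_left (H : ChevalleyRelations A h e f) (hA : IsGCM A) {i j : ι}
    (hij : i ≠ j) : ⁅f i, serreElement K A e i j⁆ = 0 := by
  have hn : (-A i j).toNat = -A i j := Int.toNat_of_nonneg (neg_nonneg.mpr (hA.nonpos hij))
  have hprim : (H.symm.isSl2Triple (hA.diag i)).HasPrimitiveVectorWith (e j)
      ((-A i j).toNat : K) :=
    { ne_zero := H.e_ne_zero j
      lie_h := by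
        rw [H.symm.lie_h_f, ← neg_smul, ← Int.cast_natCast, hn, Int.cast_smul_eq_zsmul]
      lie_e := H.symm.lie_e_f_of_ne hij }
  exact (hprim.lie_e_pow_succ_toEnd_f _).trans (by rw [sub_self, mul_zero, zero_smul])

lemma lie_f_serreElement_right (H : ChevalleyRelations A h e f) (hA : IsGCM A) {i j : ι}
    (hij : i ≠ j) : ⁅f j, serreElement K A e i j⁆ = 0 := by
  rw [serreElement, lie_ad_pow_of_lie_eq_zero (H.symm.lie_e_f_of_ne hij.symm), H.symm.lie_e_f,
    pow_succ, Module.End.mul_apply, LieAlgebra.ad_apply, ← lie_skew, H.symm.lie_h_f, neg_neg]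
  rcases hn : (-A i j).toNat with _ | n
  · have hij0 : A i j = 0 := by
      have := hA.nonpos hij
      omega
    simp [hA.zero_symm hij0]
  · simp [pow_succ, Module.End.mul_apply]

lemma lie_f_serreElement (H : ChevalleyRelations A h e f) (hA : IsGCM A) (i j k : ι) :
    ⁅f k, serreElement K A e i j⁆ = 0 := by
  rcases eq_or_ne i j with rfl | hij
  · rw [serreElement_self e i (hA.diag i), lie_zero]
  rcases eq_or_ne k i with rfl | hki
  · exact H.lie_f_serreElement_left hA hij
  rcases eq_or_ne k j with rfl | hkj
  · exact H.lie_f_serreElement_right hA hij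
  · rw [serreElement, lie_ad_pow_of_lie_eq_zero (H.symm.lie_e_f_of_ne hki),
      H.symm.lie_e_f_of_ne hkj, map_zero]

end ChevalleyRelations

end ChevalleyRelations

section AdClosure

variable {ι K L : Type*} [Field K] [LieRing L] [LieAlgebra K L]

/-- The elements of a Lie algebra whose adjoint action maps a given subspace into itself. -/
def adStabilizer (V : Submodule K L) : LieSubalgebra K L where
  carrier := {y | ∀ x ∈ V, ⁅y, x⁆ ∈ V}
  add_mem' hy hz x hx := by
    rw [add_lie]
    exact add_mem (hy x hx) (hz x hx)
  zero_mem' x _ := by simp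
  smul_mem' c y hy x hx := by
    rw [smul_lie]
    exact V.smul_mem c (hy x hx)
  lie_mem' hy hz x hx := by
    rw [lie_lie]
    exact sub_mem (hy _ (hz x hx)) (hz _ (hy x hx))

lemma eq_top_of_subset_adStabilizer {s : Set L} (hs : LieSubalgebra.lieSpan K L s = ⊤)
    {V : Submodule K L} (hsV : s ⊆ V) (hV : s ⊆ adStabilizer V) : V = ⊤ := by
  have hstab : ∀ y, y ∈ adStabilizer V := fun y =>
    LieSubalgebra.lieSpan_le.mpr hV (hs ▸ LieSubalgebra.mem_top y)
  let V' : LieSubalgebra K L := { V with lie_mem' := fun {y x} _ hx => hstab y x hx }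
  have hle : ⊤ ≤ V' := hs ▸ LieSubalgebra.lieSpan_le.mpr hsV
  exact eq_top_iff.mpr fun x _ => hle (LieSubalgebra.mem_top x)

lemma map_mem_of_mem_lieSpan {F : Type*} [LieRing F] [LieAlgebra K F] (ρ : F →ₗ⁅K⁆ L) {s r : Set F}
    (hs : LieSubalgebra.lieSpan K F s = ⊤) {V : Submodule K L}
    (hsV : ∀ y ∈ s, ρ y ∈ adStabilizer V) (hr : ∀ x ∈ r, ρ x ∈ V) {x : F}
    (hx : x ∈ LieSubmodule.lieSpan K F r) : ρ x ∈ V := by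
  have hstab : LieSubalgebra.lieSpan K F s ≤ (adStabilizer V).comap ρ :=
    LieSubalgebra.lieSpan_le.mpr hsV
  let I : LieIdeal K F :=
    { V.comap (ρ : F →ₗ[K] L) with
      lie_mem := fun {y x} hx => by
        have hy : y ∈ (adStabilizer V).comap ρ := hstab (hs ▸ LieSubalgebra.mem_top y)
        change ρ ⁅y, x⁆ ∈ V
        rw [LieHom.map_lie]
        exact hy (ρ x) hx }
  have hle : LieSubmodule.lieSpan K F r ≤ I := LieSubmodule.lieSpan_le.mpr hr
  exact hle hx

/-- The smallest subspace which contains `s` and is stable under all `ad(e_i)`. -/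
def adClosure (K : Type*) [Field K] [LieAlgebra K L] (e : ι → L) (s : Set L) : Submodule K L :=
  sInf {V | s ⊆ V ∧ ∀ i, e i ∈ adStabilizer V}

variable {e : ι → L} {s : Set L}

lemma adClosure_le {V : Submodule K L} (hs : s ⊆ V) (hV : ∀ i, e i ∈ adStabilizer V) :
    adClosure K e s ≤ V :=
  sInf_le ⟨hs, hV⟩

lemma subset_adClosure : s ⊆ adClosure K e s := fun _ hx =>
  Submodule.mem_sInf.mpr fun _ hV => hV.1 hx

lemma mem_adStabilizer_adClosure (i : ι) : e i ∈ adStabilizer (adClosure K e s) := fun x hx =>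
  Submodule.mem_sInf.mpr fun V hV => hV.2 i x (Submodule.mem_sInf.mp hx V hV)

lemma mem_adStabilizer_sup {V W : Submodule K L} {y : L} (hV : y ∈ adStabilizer V)
    (hW : y ∈ adStabilizer W) : y ∈ adStabilizer (V ⊔ W) := fun x hx => by
  obtain ⟨v, hv, w, hw, rfl⟩ := Submodule.mem_sup.mp hx
  rw [lie_add]
  exact Submodule.add_mem_sup (hV v hv) (hW w hw)

lemma mem_adStabilizer_span {y : L} (hy : ∀ x ∈ s, ⁅y, x⁆ ∈ Submodule.span K s) :
    y ∈ adStabilizer (Submodule.span K s) := by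
  have hle : Submodule.span K s ≤ (Submodule.span K s).comap (LieAlgebra.ad K L y) :=
    Submodule.span_le.mpr hy
  exact fun x hx => hle hx

namespace ChevalleyRelations

variable {A : Matrix ι ι ℤ} {h f : ι → L}

lemma h_mem_adStabilizer_adClosure (H : ChevalleyRelations A h e f) (k : ι)
    (hs : ∀ x ∈ s, ⁅h k, x⁆ ∈ adClosure K e s) : h k ∈ adStabilizer (adClosure K e s) := by
  suffices adClosure K e s ≤ adClosure K e s ⊓ (adClosure K e s).comap (LieAlgebra.ad K L (h k))
    from fun x hx => (this hx).2
  refine adClosure_le (fun x hx => ⟨subset_adClosure hx, hs x hx⟩) fun i x ⟨hx, hhx⟩ =>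
    ⟨mem_adStabilizer_adClosure i x hx, ?_⟩
  rw [SetLike.mem_coe, Submodule.mem_comap, LieAlgebra.ad_apply, leibniz_lie, H.lie_h_e, zsmul_lie]
  exact add_mem (zsmul_mem (mem_adStabilizer_adClosure i x hx) _)
    (mem_adStabilizer_adClosure i _ hhx)

lemma lie_f_mem_sup_adClosure (H : ChevalleyRelations A h e f) {W : Submodule K L}
    (hW : ∀ i, ∀ x ∈ W, ⁅e i, x⁆ ∈ adClosure K e s)
    (hsh : ∀ k, ∀ x ∈ s, ⁅h k, x⁆ ∈ adClosure K e s) {k : ι}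
    (hsf : ∀ x ∈ s, ⁅f k, x⁆ ∈ W ⊔ adClosure K e s) {x : L} (hx : x ∈ adClosure K e s) :
    ⁅f k, x⁆ ∈ W ⊔ adClosure K e s := by
  suffices adClosure K e s ≤
      adClosure K e s ⊓ (W ⊔ adClosure K e s).comap (LieAlgebra.ad K L (f k)) from (this hx).2
  refine adClosure_le (fun x hx => ⟨subset_adClosure hx, hsf x hx⟩) fun i x ⟨hx, hfx⟩ =>
    ⟨mem_adStabilizer_adClosure i x hx, ?_⟩
  rw [SetLike.mem_coe, Submodule.mem_comap, LieAlgebra.ad_apply, leibniz_lie]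
  refine Submodule.mem_sup_right (add_mem ?_ ?_)
  · rcases eq_or_ne k i with rfl | hki
    · rw [H.symm.lie_e_f, Pi.neg_apply, neg_lie]
      exact neg_mem (H.h_mem_adStabilizer_adClosure k (hsh k) x hx)
    · rw [H.symm.lie_e_f_of_ne hki, zero_lie]
      exact zero_mem _
  · obtain ⟨w, hw, v, hv, hwv⟩ := Submodule.mem_sup.mp hfx
    rw [← show w + v = ⁅f k, x⁆ from hwv, lie_add]
    exact add_mem (hW i w hw) (mem_adStabilizer_adClosure i v hv)

end ChevalleyRelations

end AdClosure

section SerreClosure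

variable {ι K L : Type*} [Field K] [LieRing L] [LieAlgebra K L]

/-- The span of all iterated brackets of the `e_i` with a Serre element. In the Lie algebra
presented by the `ChevalleyRelations` alone this is the ideal generated by the Serre elements. -/
def serreClosure (K : Type*) [Field K] [LieAlgebra K L] (A : Matrix ι ι ℤ) (e : ι → L) :
    Submodule K L :=
  adClosure K e (Set.range fun p : ι × ι => serreElement K A e p.1 p.2)

variable {A : Matrix ι ι ℤ} {h e f : ι → L}

lemma serreElement_mem_serreClosure (i j : ι) : serreElement K A e i j ∈ serreClosure K A e :=
  subset_adClosure ⟨(i, j), rfl⟩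

lemma serreClosure_le {B : LieSubalgebra K L} (he : ∀ i, e i ∈ B) :
    serreClosure K A e ≤ B.toSubmodule := by
  refine adClosure_le ?_ fun i x hx => B.lie_mem (he i) hx
  rintro _ ⟨⟨i, j⟩, rfl⟩
  exact Module.End.pow_apply_mem_of_forall_mem _ (fun x hx => B.lie_mem (he i) hx) _ (he j)

namespace ChevalleyRelations

lemma lie_h_mem_serreClosure (H : ChevalleyRelations A h e f) (k : ι) {x : L}
    (hx : x ∈ Set.range fun p : ι × ι => serreElement K A e p.1 p.2) :
    ⁅h k, x⁆ ∈ serreClosure K A e := by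
  obtain ⟨⟨i, j⟩, rfl⟩ := hx
  obtain ⟨c, hc⟩ := H.lie_h_serreElement (K := K) i j k
  rw [hc]
  exact Submodule.smul_mem _ c (serreElement_mem_serreClosure i j)

lemma h_mem_adStabilizer_serreClosure (H : ChevalleyRelations A h e f) (k : ι) :
    h k ∈ adStabilizer (serreClosure K A e) :=
  H.h_mem_adStabilizer_adClosure k fun _ => H.lie_h_mem_serreClosure k

lemma f_mem_adStabilizer_serreClosure (H : ChevalleyRelations A h e f) (hA : IsGCM A) (k : ι) :
    f k ∈ adStabilizer (serreClosure K A e) := fun x hx => by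
  rw [serreClosure, ← bot_sup_eq (adClosure _ _ _)]
  refine H.lie_f_mem_sup_adClosure (by simp) (fun k _ => H.lie_h_mem_serreClosure k) ?_ hx
  rintro _ ⟨⟨i, j⟩, rfl⟩
  rw [H.lie_f_serreElement hA]
  exact zero_mem _

end ChevalleyRelations

lemma lieSpan_range_freeLieAlgebra_of (X : Type*) :
    LieSubalgebra.lieSpan K (FreeLieAlgebra K X) (Set.range (FreeLieAlgebra.of K)) = ⊤ := by
  set S := LieSubalgebra.lieSpan K (FreeLieAlgebra K X) (Set.range (FreeLieAlgebra.of K))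
  have hretract : S.incl.comp (FreeLieAlgebra.lift K fun x =>
      (⟨FreeLieAlgebra.of K x, LieSubalgebra.subset_lieSpan ⟨x, rfl⟩⟩ : S)) = LieHom.id :=
    FreeLieAlgebra.hom_ext fun x => by simp
  refine eq_top_iff.mpr fun y _ => ?_
  rw [← LieHom.id_apply (R := K) y, ← hretract]
  exact Subtype.property _

lemma map_ad_pow {F : Type*} [LieRing F] [LieAlgebra K F] (ρ : F →ₗ⁅K⁆ L) (y x : F) (n : ℕ) :
    ρ ((LieAlgebra.ad K F y ^ n) x) = (LieAlgebra.ad K L (ρ y) ^ n) (ρ x) := by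
  induction n with
  | zero => simp
  | succ n ih => simp [pow_succ', Module.End.mul_apply, ih]

open CartanMatrix in
lemma ChevalleyRelations.map_mem_of_mem_toIdeal [DecidableEq ι] (hA : IsGCM A)
    (ρ : FreeLieAlgebra K (Generators ι) →ₗ⁅K⁆ L)
    (H : ChevalleyRelations A (fun i => ρ (.of K (.H i))) (fun i => ρ (.of K (.E i)))
      (fun i => ρ (.of K (.F i))))
    {x : FreeLieAlgebra K (Generators ι)} (hx : x ∈ Relations.toIdeal K A) :
    ρ x ∈ serreClosure K A (fun i => ρ (.of K (.E i))) ⊔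
      serreClosure K A (fun i => ρ (.of K (.F i))) := by
  refine map_mem_of_mem_lieSpan ρ (lieSpan_range_freeLieAlgebra_of _) ?_ ?_ hx
  · rintro _ ⟨i | i | i, rfl⟩
    · exact mem_adStabilizer_sup (H.h_mem_adStabilizer_serreClosure i)
        (neg_mem_iff.mp (H.symm.h_mem_adStabilizer_serreClosure i))
    · exact mem_adStabilizer_sup (mem_adStabilizer_adClosure i)
        (H.symm.f_mem_adStabilizer_serreClosure hA i)
    · exact mem_adStabilizer_sup (H.f_mem_adStabilizer_serreClosure hA i)
        (mem_adStabilizer_adClosure i)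
  · rintro _ (((((⟨⟨i, j⟩, rfl⟩ | ⟨⟨i, j⟩, rfl⟩) | ⟨⟨i, j⟩, rfl⟩) | ⟨⟨i, j⟩, rfl⟩) |
      ⟨⟨i, j⟩, rfl⟩) | ⟨⟨i, j⟩, rfl⟩)
    · simp [Relations.HH, H.lie_h_h]
    · rcases eq_or_ne i j with rfl | hij
      · simp [Relations.EF, H.lie_e_f]
      · simp [Relations.EF, hij, H.lie_e_f_of_ne]
    · simp [Relations.HE, H.lie_h_e]
    · simp [Relations.HF, H.lie_h_f]
    · refine Submodule.mem_sup_left ?_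
      simpa [Relations.adE, map_ad_pow, serreElement, pow_succ] using
        serreElement_mem_serreClosure i j
    · refine Submodule.mem_sup_right ?_
      simpa [Relations.adF, map_ad_pow, serreElement, pow_succ] using
        serreElement_mem_serreClosure i j

end SerreClosure

section Verma

attribute [local instance] LieRing.ofAssociativeRing

variable {K : Type*} [Field K] {ι : Type*}

section

variable {M : Type*} [AddCommGroup M] [Module K M] {A : Matrix ι ι ℤ} {e : ι → Module.End K M}

lemma apply_eq_zero_of_mem_serreClosure {v : M} (he : ∀ i, e i v = 0) {T : Module.End K M}
    (hT : T ∈ serreClosure K A e) : T v = 0 := by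
  let B : LieSubalgebra K (Module.End K M) :=
    { LinearMap.ker (LinearMap.applyₗ (R := K) (M₂ := M) v) with
      lie_mem' := fun {S T} hS hT => by
        have hS : S v = 0 := hS
        have hT : T v = 0 := hT
        simp [Ring.lie_def, hS, hT] }
  exact serreClosure_le (B := B) he hT

lemma comp_eq_zero_of_mem_serreClosure {φ : Module.Dual K M} (he : ∀ i, φ ∘ₗ e i = 0)
    {T : Module.End K M} (hT : T ∈ serreClosure K A e) : φ ∘ₗ T = 0 := by
  let B : LieSubalgebra K (Module.End K M) :=
    { LinearMap.ker (LinearMap.compRight K (M := M) φ) with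
      lie_mem' := fun {S T} hS hT => by
        have hS : φ ∘ₗ S = 0 := hS
        have hT : φ ∘ₗ T = 0 := hT
        change φ ∘ₗ (S * T - T * S) = 0
        rw [LinearMap.comp_sub, Module.End.mul_eq_comp, Module.End.mul_eq_comp,
          ← LinearMap.comp_assoc, ← LinearMap.comp_assoc, hS, hT, LinearMap.zero_comp,
          LinearMap.zero_comp, sub_zero] }
  exact serreClosure_le (B := B) he hT

end

namespace Verma

variable (K) (A : Matrix ι ι ℤ)

/-- The eigenvalue of `h_i` on the basis vector `f_{w_1} ⋯ f_{w_r} v` of the Verma module with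
highest weight vector `v` of weight `(1, 1, …)`, for the Lie algebra without Serre relations. The
free `K`-module on `List ι` serves as the underlying space, with `[]` in the role of `v`. -/
def weight (i : ι) (w : List ι) : ℤ := 1 - (w.map (A i)).sum

/-- The action of `h_i` on the Verma module. -/
noncomputable def h (i : ι) : Module.End K (List ι →₀ K) :=
  Finsupp.linearCombination K fun w => (weight A i w : K) • Finsupp.single w 1

/-- The action of `f_i` on the Verma module. -/
noncomputable def f (i : ι) : Module.End K (List ι →₀ K) :=
  Finsupp.linearCombination K fun w => Finsupp.single (i :: w) 1

/-- The action of `e_i` on the basis of the Verma module, as forced by `e_i v = 0` and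
`e_i f_j = f_j e_i + δ_{ij} h_i`. -/
noncomputable def eBasis [DecidableEq ι] (i : ι) : List ι → (List ι →₀ K)
  | [] => 0
  | j :: w => f K j (eBasis i w) + if i = j then h K A i (Finsupp.single w 1) else 0

/-- The action of `e_i` on the Verma module. -/
noncomputable def e [DecidableEq ι] (i : ι) : Module.End K (List ι →₀ K) :=
  Finsupp.linearCombination K (eBasis K A i)

lemma h_single (i : ι) (w : List ι) :
    h K A i (Finsupp.single w 1) = (weight A i w : K) • Finsupp.single w 1 := by
  rw [h, Finsupp.linearCombination_single, one_smul]

lemma f_single (i : ι) (w : List ι) : f K i (Finsupp.single w 1) = Finsupp.single (i :: w) 1 := by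
  rw [f, Finsupp.linearCombination_single, one_smul]

lemma e_single_nil [DecidableEq ι] (i : ι) : e K A i (Finsupp.single [] 1) = 0 := by
  rw [e, Finsupp.linearCombination_single, eBasis, smul_zero]

lemma e_single_cons [DecidableEq ι] (i j : ι) (w : List ι) :
    e K A i (Finsupp.single (j :: w) 1) = f K j (e K A i (Finsupp.single w 1)) +
      if i = j then h K A i (Finsupp.single w 1) else 0 := by
  simp only [e, Finsupp.linearCombination_single, one_smul, eBasis]

lemma h_single_nil_apply (i : ι) : h K A i (Finsupp.single [] 1) [] = 1 := by
  simp [h_single, weight]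

lemma lapply_nil_comp_f (i : ι) : Finsupp.lapply [] ∘ₗ f K i = 0 := by
  refine Finsupp.lhom_ext' fun w => LinearMap.ext_ring ?_
  simp [f_single]

variable {K} in
lemma ext_single {S T : Module.End K (List ι →₀ K)}
    (hST : ∀ w, S (Finsupp.single w 1) = T (Finsupp.single w 1)) : S = T :=
  Finsupp.lhom_ext' fun w => LinearMap.ext_ring (hST w)

lemma h_mul_h (i j : ι) : h K A i * h K A j = h K A j * h K A i := ext_single fun w => by
  simp only [Module.End.mul_apply, h_single, map_smul]
  exact smul_comm ..

lemma h_mul_f (i j : ι) : h K A i * f K j = f K j * h K A i - A i j • f K j :=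
  ext_single fun w => by
    simp only [Module.End.mul_apply, LinearMap.sub_apply, LinearMap.smul_apply, h_single, f_single,
      map_smul]
    rw [← Int.cast_smul_eq_zsmul K, ← sub_smul]
    congr 1
    push_cast [weight, List.map_cons, List.sum_cons]
    ring

lemma e_mul_f [DecidableEq ι] (i j : ι) :
    e K A i * f K j = f K j * e K A i + if i = j then h K A i else 0 :=
  ext_single fun w => by
    simp only [Module.End.mul_apply, LinearMap.add_apply, f_single, e_single_cons]
    split_ifs <;> rfl

lemma h_e_single [DecidableEq ι] (i j : ι) (w : List ι) :
    h K A i (e K A j (Finsupp.single w 1)) =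
      ((weight A i w + A i j : ℤ) : K) • e K A j (Finsupp.single w 1) := by
  induction w with
  | nil => simp [e_single_nil]
  | cons l w ih =>
    have hweight : weight A i (l :: w) = weight A i w - A i l := by
      simp only [weight, List.map_cons, List.sum_cons]
      ring
    have hf := LinearMap.congr_fun (h_mul_f K A i l) (e K A j (Finsupp.single w 1))
    simp only [Module.End.mul_apply, LinearMap.sub_apply, LinearMap.smul_apply, ih, map_smul,
      ← Int.cast_smul_eq_zsmul K, ← sub_smul] at hf
    rw [e_single_cons, map_add, hf, hweight, smul_add]
    congr 1
    · congr 1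
      push_cast
      ring
    · split_ifs with hjl
      · rw [← Module.End.mul_apply, h_mul_h, Module.End.mul_apply, h_single K A i, map_smul, hjl,
          sub_add_cancel]
      · simp

lemma h_mul_e [DecidableEq ι] (i j : ι) :
    h K A i * e K A j = e K A j * h K A i + A i j • e K A j := ext_single fun w => by
  rw [Module.End.mul_apply, h_e_single, LinearMap.add_apply, Module.End.mul_apply, h_single,
    map_smul, LinearMap.smul_apply, ← Int.cast_smul_eq_zsmul K, ← add_smul, Int.cast_add]

lemma chevalleyRelations [DecidableEq ι] : ChevalleyRelations A (h K A) (e K A) (f K) where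
  h_ne_zero i h0 := by simpa [h0] using h_single_nil_apply K A i
  lie_h_h i j := (Ring.lie_def _ _).trans (sub_eq_zero.mpr (h_mul_h K A i j))
  lie_e_f i := (Ring.lie_def _ _).trans
    (sub_eq_iff_eq_add'.mpr ((e_mul_f K A i i).trans (by rw [if_pos rfl])))
  lie_e_f_of_ne hij := (Ring.lie_def _ _).trans
    (sub_eq_zero.mpr ((e_mul_f K A _ _).trans (by rw [if_neg hij, add_zero])))
  lie_h_e i j := (Ring.lie_def _ _).trans (sub_eq_iff_eq_add'.mpr (h_mul_e K A i j))
  lie_h_f i j := (Ring.lie_def _ _).trans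
    (sub_eq_iff_eq_add'.mpr ((h_mul_f K A i j).trans (sub_eq_add_neg (f K j * h K A i) _)))

end Verma

lemma h_ne_zero [DecidableEq ι] {A : Matrix ι ι ℤ} (hA : IsGCM A) (i : ι) : h K A i ≠ 0 := by
  intro h0
  let ρ : FreeLieAlgebra K (CartanMatrix.Generators ι) →ₗ⁅K⁆ Module.End K (List ι →₀ K) :=
    FreeLieAlgebra.lift K fun
      | .H i => Verma.h K A i
      | .E i => Verma.e K A i
      | .F i => Verma.f K i
  have hρ : ρ (.of K (.H i)) = Verma.h K A i := FreeLieAlgebra.lift_of_apply ..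
  have H : ChevalleyRelations A (fun i => ρ (.of K (.H i))) (fun i => ρ (.of K (.E i)))
      (fun i => ρ (.of K (.F i))) := by
    simpa only [ρ, FreeLieAlgebra.lift_of_apply] using Verma.chevalleyRelations K A
  obtain ⟨S, hS, T, hT, hST⟩ := Submodule.mem_sup.mp
    (H.map_mem_of_mem_toIdeal hA ρ (LieSubmodule.Quotient.mk_eq_zero'.mp h0))
  have hSv : S (Finsupp.single [] 1) = 0 := apply_eq_zero_of_mem_serreClosure
    (fun i => by simpa only [ρ, FreeLieAlgebra.lift_of_apply] using Verma.e_single_nil K A i) hS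
  have hTv : Finsupp.lapply [] ∘ₗ T = 0 := comp_eq_zero_of_mem_serreClosure
    (fun i => by simpa only [ρ, FreeLieAlgebra.lift_of_apply] using Verma.lapply_nil_comp_f K i) hT
  have hvac := Verma.h_single_nil_apply K A i
  rw [← hρ, ← hST, LinearMap.add_apply, hSv, zero_add] at hvac
  exact zero_ne_one ((LinearMap.congr_fun hTv (Finsupp.single [] 1)).symm.trans hvac)

end Verma

section ChevalleySystem

variable {ι L : Type*} [LieRing L] (K : Type*) [Field K] [LieAlgebra K L]

/-- A family of Chevalley generators `e i`, `f i` of a Kac-Moody algebra, with coroots `h i`: the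
elements `e i` and `f i` generate the Lie algebra and satisfy the Serre relations, too. Exchanging
the `e i` with the `f i` leads to another such family, so that every result on the `e i` has its
counterpart for the `f i`. -/
structure ChevalleySystem (A : Matrix ι ι ℤ) (h e f : ι → L) : Prop
    extends ChevalleyRelations A h e f where
  serreElement_e : ∀ i j, serreElement K A e i j = 0
  serreElement_f : ∀ i j, serreElement K A f i j = 0
  lieSpan_eq_top : LieSubalgebra.lieSpan K L (Set.range e ∪ Set.range f) = ⊤

namespace ChevalleySystem

variable {K} {A : Matrix ι ι ℤ} {h e f : ι → L}

lemma symm (H : ChevalleySystem K A h e f) : ChevalleySystem K A (-h) f e where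
  toChevalleyRelations := H.toChevalleyRelations.symm
  serreElement_e := H.serreElement_f
  serreElement_f := H.serreElement_e
  lieSpan_eq_top := Set.union_comm _ _ ▸ H.lieSpan_eq_top

lemma exists_ad_e_pow_eq_zero (H : ChevalleySystem K A h e f) (i : ι) (x : L) :
    ∃ n, (LieAlgebra.ad K L (e i) ^ n) x = 0 := by
  suffices LieSubalgebra.engel K (e i) = ⊤ by
    rw [← LieSubalgebra.mem_engel_iff, this]
    exact LieSubalgebra.mem_top x
  rw [eq_top_iff, ← H.lieSpan_eq_top, LieSubalgebra.lieSpan_le]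
  rintro _ (⟨j, rfl⟩ | ⟨j, rfl⟩) <;> refine (LieSubalgebra.mem_engel_iff ..).mpr ?_
  · exact ⟨_, H.serreElement_e i j⟩
  · refine ⟨3, ?_⟩
    rw [pow_succ, Module.End.mul_apply, LieAlgebra.ad_apply]
    rcases eq_or_ne i j with rfl | hij
    · rw [H.lie_e_f, pow_two, Module.End.mul_apply, LieAlgebra.ad_apply, LieAlgebra.ad_apply,
        ← lie_skew (e i) (h i), H.lie_h_e]
      simp
    · rw [H.lie_e_f_of_ne hij, map_zero]

end ChevalleySystem

variable [DecidableEq ι] (A : Matrix ι ι ℤ)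

/-- The Chevalley generator `e_i`. -/
noncomputable def e (i : ι) : Matrix.ToLieAlgebra K A :=
  mk K A (FreeLieAlgebra.of K (CartanMatrix.Generators.E i))

/-- The quotient map from the free Lie algebra as a homomorphism of Lie algebras. -/
noncomputable def mkHom :
    FreeLieAlgebra K (CartanMatrix.Generators ι) →ₗ⁅K⁆ Matrix.ToLieAlgebra K A where
  toFun := mk K A
  map_add' _ _ := rfl
  map_smul' _ _ := rfl
  map_lie' := rfl

lemma mkHom_eq_zero {x : FreeLieAlgebra K (CartanMatrix.Generators ι)}
    (hx : x ∈ CartanMatrix.Relations.toSet K A) : mkHom K A x = 0 :=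
  LieSubmodule.Quotient.mk_eq_zero'.mpr (LieSubmodule.subset_lieSpan hx)

lemma lie_h_h (i j : ι) : ⁅h K A i, h K A j⁆ = 0 :=
  mkHom_eq_zero K A (.inl (.inl (.inl (.inl (.inl ⟨(i, j), rfl⟩)))))

lemma lie_e_f (i j : ι) : ⁅e K A i, f K A j⁆ = if i = j then h K A i else 0 := by
  have hrel := mkHom_eq_zero K A (.inl (.inl (.inl (.inl (.inr ⟨(i, j), rfl⟩)))))
  simp only [CartanMatrix.Relations.EF, Function.uncurry] at hrel
  split_ifs at hrel ⊢ with hij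
  · rw [map_sub, LieHom.map_lie] at hrel
    subst hij
    exact sub_eq_zero.mp hrel
  · rw [LieHom.map_lie] at hrel
    exact hrel

lemma lie_h_e (i j : ι) : ⁅h K A i, e K A j⁆ = A i j • e K A j := by
  have hrel := mkHom_eq_zero K A (.inl (.inl (.inl (.inr ⟨(i, j), rfl⟩))))
  simp only [CartanMatrix.Relations.HE, Function.uncurry, map_sub, LieHom.map_lie,
    map_zsmul] at hrel
  exact sub_eq_zero.mp hrel

lemma lie_h_f (i j : ι) : ⁅h K A i, f K A j⁆ = -(A i j • f K A j) := by
  have hrel := mkHom_eq_zero K A (.inl (.inl (.inr ⟨(i, j), rfl⟩)))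
  simp only [CartanMatrix.Relations.HF, Function.uncurry, map_add, LieHom.map_lie,
    map_zsmul] at hrel
  exact eq_neg_of_add_eq_zero_left hrel

lemma serreElement_e (i j : ι) : serreElement K A (e K A) i j = 0 := by
  have hrel := mkHom_eq_zero K A (.inl (.inr ⟨(i, j), rfl⟩))
  simp only [CartanMatrix.Relations.adE, Function.uncurry, map_ad_pow, LieHom.map_lie] at hrel
  rw [serreElement, pow_succ]
  exact hrel

lemma serreElement_f (i j : ι) : serreElement K A (f K A) i j = 0 := by
  have hrel := mkHom_eq_zero K A (.inr ⟨(i, j), rfl⟩)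
  simp only [CartanMatrix.Relations.adF, Function.uncurry, map_ad_pow, LieHom.map_lie] at hrel
  rw [serreElement, pow_succ]
  exact hrel

lemma lieSpan_range_e_union_range_f : LieSubalgebra.lieSpan K (Matrix.ToLieAlgebra K A)
    (Set.range (e K A) ∪ Set.range (f K A)) = ⊤ := by
  set S := LieSubalgebra.lieSpan K (Matrix.ToLieAlgebra K A)
    (Set.range (e K A) ∪ Set.range (f K A))
  have he : ∀ i, e K A i ∈ S := fun i => LieSubalgebra.subset_lieSpan (.inl ⟨i, rfl⟩)
  have hf : ∀ i, f K A i ∈ S := fun i => LieSubalgebra.subset_lieSpan (.inr ⟨i, rfl⟩)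
  have hcomap : S.comap (mkHom K A) = ⊤ := by
    rw [eq_top_iff, ← lieSpan_range_freeLieAlgebra_of, LieSubalgebra.lieSpan_le]
    rintro _ ⟨i | i | i, rfl⟩
    · have hh := S.lie_mem (he i) (hf i)
      rwa [lie_e_f, if_pos rfl] at hh
    · exact he i
    · exact hf i
  refine eq_top_iff.mpr fun x _ => ?_
  obtain ⟨y, rfl⟩ : ∃ y, mkHom K A y = x := Quot.exists_rep x
  have hy : y ∈ S.comap (mkHom K A) := hcomap ▸ LieSubalgebra.mem_top y
  exact hy

lemma chevalleySystem {A : Matrix ι ι ℤ} (hA : IsGCM A) :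
    ChevalleySystem K A (h K A) (e K A) (f K A) where
  h_ne_zero := h_ne_zero hA
  lie_h_h := lie_h_h K A
  lie_e_f i := by rw [lie_e_f, if_pos rfl]
  lie_e_f_of_ne hij := by rw [lie_e_f, if_neg hij]
  lie_h_e := lie_h_e K A
  lie_h_f := lie_h_f K A
  serreElement_e := serreElement_e K A
  serreElement_f := serreElement_f K A
  lieSpan_eq_top := lieSpan_range_e_union_range_f K A

end ChevalleySystem

section TriangularDecomposition

variable {ι K L : Type*} [Field K] [LieRing L] [LieAlgebra K L] {A : Matrix ι ι ℤ} {h e f : ι → L}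

namespace ChevalleyRelations

lemma lie_e_mem_of_mem_span_range_h (H : ChevalleyRelations A h e f) (i : ι) {x : L}
    (hx : x ∈ Submodule.span K (Set.range h)) : ⁅e i, x⁆ ∈ adClosure K e (Set.range e) := by
  suffices Submodule.span K (Set.range h) ≤
      (adClosure K e (Set.range e)).comap (LieAlgebra.ad K L (e i)) from this hx
  rw [Submodule.span_le]
  rintro _ ⟨j, rfl⟩
  rw [SetLike.mem_coe, Submodule.mem_comap, LieAlgebra.ad_apply, ← lie_skew, H.lie_h_e]
  exact neg_mem (zsmul_mem (subset_adClosure (Set.mem_range_self i)) _)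

lemma lie_f_mem_span_range_h_sup_adClosure (H : ChevalleyRelations A h e f) (k : ι) {x : L}
    (hx : x ∈ adClosure K e (Set.range e)) :
    ⁅f k, x⁆ ∈ Submodule.span K (Set.range h) ⊔ adClosure K e (Set.range e) := by
  refine H.lie_f_mem_sup_adClosure (fun i x => H.lie_e_mem_of_mem_span_range_h i) ?_ ?_ hx
  · rintro k _ ⟨i, rfl⟩
    rw [H.lie_h_e]
    exact zsmul_mem (subset_adClosure (Set.mem_range_self i)) _
  · rintro _ ⟨i, rfl⟩
    rcases eq_or_ne k i with rfl | hki
    · rw [H.symm.lie_e_f]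
      exact Submodule.mem_sup_left (neg_mem (Submodule.subset_span ⟨k, rfl⟩))
    · rw [H.symm.lie_e_f_of_ne hki]
      exact zero_mem _

lemma span_range_neg_h : Submodule.span K (Set.range (-h)) = Submodule.span K (Set.range h) := by
  rw [← Set.neg_range', Submodule.span_neg]

lemma e_mem_adStabilizer_sup (H : ChevalleyRelations A h e f) (i : ι) :
    e i ∈ adStabilizer (Submodule.span K (Set.range h) ⊔ adClosure K e (Set.range e) ⊔
      adClosure K f (Set.range f)) := fun x hx => by
  obtain ⟨_, hx', c, hc, rfl⟩ := Submodule.mem_sup.mp hx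
  obtain ⟨a, ha, b, hb, rfl⟩ := Submodule.mem_sup.mp hx'
  have hsym := H.symm.lie_f_mem_span_range_h_sup_adClosure i hc
  rw [span_range_neg_h] at hsym
  rw [lie_add, lie_add]
  refine add_mem (Submodule.mem_sup_left (Submodule.mem_sup_right (add_mem ?_ ?_))) ?_
  · exact H.lie_e_mem_of_mem_span_range_h i ha
  · exact mem_adStabilizer_adClosure i b hb
  · exact sup_le_sup_right (le_sup_left (a := Submodule.span K (Set.range h))) _ hsym

lemma f_mem_adStabilizer_sup (H : ChevalleyRelations A h e f) (i : ι) :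
    f i ∈ adStabilizer (Submodule.span K (Set.range h) ⊔ adClosure K e (Set.range e) ⊔
      adClosure K f (Set.range f)) := by
  have hsym := H.symm.e_mem_adStabilizer_sup (K := K) i
  rwa [span_range_neg_h, sup_right_comm] at hsym

end ChevalleyRelations

lemma ChevalleySystem.span_sup_adClosure_sup_adClosure (H : ChevalleySystem K A h e f) :
    Submodule.span K (Set.range h) ⊔ adClosure K e (Set.range e) ⊔
      adClosure K f (Set.range f) = ⊤ := by
  refine eq_top_of_subset_adStabilizer H.lieSpan_eq_top (Set.union_subset ?_ ?_)
    (Set.union_subset ?_ ?_)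
  · exact fun x hx => Submodule.mem_sup_left (Submodule.mem_sup_right (subset_adClosure hx))
  · exact fun x hx => Submodule.mem_sup_right (subset_adClosure hx)
  · exact Set.range_subset_iff.mpr H.e_mem_adStabilizer_sup
  · exact Set.range_subset_iff.mpr H.f_mem_adStabilizer_sup

end TriangularDecomposition

section PositiveNonMultiple

variable {ι : Type*}

/-- The positive elements of the root lattice which are not multiples of a simple root. -/
def IsPositiveNonMultiple (k : ι → ℤ) : Prop := 0 ≤ k ∧ ∃ i j, i ≠ j ∧ 0 < k i ∧ 0 < k j

variable [DecidableEq ι]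

lemma IsPositiveNonMultiple.single_add {k : ι → ℤ} (hk : IsPositiveNonMultiple k) (i : ι) :
    IsPositiveNonMultiple (Pi.single i 1 + k) := by
  have hle : k ≤ Pi.single i 1 + k := le_add_of_nonneg_left (Pi.single_nonneg.mpr zero_le_one)
  obtain ⟨hk0, a, b, hab, ha, hb⟩ := hk
  exact ⟨hk0.trans hle, a, b, hab, ha.trans_le (hle a), hb.trans_le (hle b)⟩

lemma isPositiveNonMultiple_single_add_single {i j : ι} (hij : i ≠ j) :
    IsPositiveNonMultiple (Pi.single i 1 + Pi.single j 1) :=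
  ⟨add_nonneg (Pi.single_nonneg.mpr zero_le_one) (Pi.single_nonneg.mpr zero_le_one), i, j, hij,
    by simp [hij], by simp [hij.symm]⟩

lemma not_isPositiveNonMultiple_single (i : ι) : ¬ IsPositiveNonMultiple (Pi.single i 1) := by
  rintro ⟨-, a, b, hab, ha, hb⟩
  refine hab ((?_ : a = i).trans (?_ : b = i).symm) <;> by_contra hne <;>
    simp [Pi.single_eq_of_ne hne] at ha hb

end PositiveNonMultiple

section WeightSpaces

variable {ι L : Type*} [Fintype ι] [LieRing L] (K : Type*) [Field K] [LieAlgebra K L]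

/-- The weight space of the element `∑ j, k j • α_j` of the root lattice, where `α_j` takes the
value `A i j` on `h i`. For the Chevalley generators of `Matrix.ToLieAlgebra K A` it is
`KacMoody.rootSpace K A k`. -/
def weightSpace (A : Matrix ι ι ℤ) (h : ι → L) (k : ι → ℤ) : Submodule K L :=
  ⨅ i, (LieAlgebra.ad K L (h i)).eigenspace ((A.mulVec k i : ℤ) : K)

variable {K} {A : Matrix ι ι ℤ} {h e f : ι → L} {k l : ι → ℤ} {x y : L}

lemma mem_weightSpace :
    x ∈ weightSpace K A h k ↔ ∀ i, ⁅h i, x⁆ = ((A.mulVec k i : ℤ) : K) • x := by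
  simp only [weightSpace, Submodule.mem_iInf, Module.End.mem_eigenspace_iff, LieAlgebra.ad_apply]

lemma weightSpace_neg : weightSpace K A (-h) (-k) = weightSpace K A h k := by
  ext x
  simp only [mem_weightSpace, Matrix.mulVec_neg, Pi.neg_apply, neg_lie, Int.cast_neg, neg_smul,
    neg_inj]

lemma lie_mem_weightSpace (hx : x ∈ weightSpace K A h k) (hy : y ∈ weightSpace K A h l) :
    ⁅x, y⁆ ∈ weightSpace K A h (k + l) := mem_weightSpace.mpr fun i => by
  rw [leibniz_lie, mem_weightSpace.mp hx, mem_weightSpace.mp hy, smul_lie, lie_smul, ← add_smul,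
    Matrix.mulVec_add, Pi.add_apply, Int.cast_add]

lemma ad_pow_mem_weightSpace (hy : y ∈ weightSpace K A h l) (hx : x ∈ weightSpace K A h k)
    (n : ℕ) : (LieAlgebra.ad K L y ^ n) x ∈ weightSpace K A h (k + n • l) := by
  induction n with
  | zero => simpa using hx
  | succ n ih =>
    rw [pow_succ', Module.End.mul_apply, succ_nsmul', add_left_comm]
    exact lie_mem_weightSpace hy ih

namespace ChevalleyRelations

lemma h_mem_weightSpace (H : ChevalleyRelations A h e f) (i : ι) : h i ∈ weightSpace K A h 0 :=
  mem_weightSpace.mpr fun j => by simp [H.lie_h_h]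

lemma e_mem_weightSpace [DecidableEq ι] (H : ChevalleyRelations A h e f) (i : ι) :
    e i ∈ weightSpace K A h (Pi.single i 1) := mem_weightSpace.mpr fun j => by
  rw [H.lie_h_e, Matrix.mulVec_single_one, Matrix.col_apply, Int.cast_smul_eq_zsmul]

lemma f_mem_weightSpace [DecidableEq ι] (H : ChevalleyRelations A h e f) (i : ι) :
    f i ∈ weightSpace K A h (-Pi.single i 1) := by
  rw [← weightSpace_neg, neg_neg]
  exact H.symm.e_mem_weightSpace i

lemma iSupIndep_weightSpace [CharZero K] (H : ChevalleyRelations A h e f)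
    (hA : Function.Injective A.mulVec) : iSupIndep (weightSpace K A h) := by
  have hcomm : ∀ i j, Commute (LieAlgebra.ad K L (h i)) (LieAlgebra.ad K L (h j)) := fun i j =>
    LinearMap.ext fun x => by simp [leibniz_lie (h i) (h j) x, H.lie_h_h]
  have hindep := Module.End.independent_iInf_maxGenEigenspace_of_forall_mapsTo
    (fun i => LieAlgebra.ad K L (h i))
    fun i j c => Module.End.mapsTo_maxGenEigenspace_of_comm (hcomm j i) c
  have hinj : Function.Injective fun (k : ι → ℤ) i => ((A.mulVec k i : ℤ) : K) :=
    fun k l hkl => hA (funext fun i => Int.cast_injective (congrFun hkl i))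
  exact (hindep.comp hinj).mono fun k =>
    iInf_mono fun i => Module.End.genEigenspace_le_maximal _ _ 1

end ChevalleyRelations

variable [DecidableEq ι]

/-- A spanning set of the weight space of a positive element `k` of the root lattice, which is empty
if `k` is a proper multiple of a simple root. -/
def positiveRootVectors (K : Type*) [Field K] [LieAlgebra K L] (A : Matrix ι ι ℤ) (h e : ι → L)
    (k : ι → ℤ) : Set L :=
  {x ∈ weightSpace K A h k | IsPositiveNonMultiple k ∨ ∃ i, k = Pi.single i 1 ∧ x = e i}

lemma ChevalleyRelations.adClosure_le_span (H : ChevalleyRelations A h e f) :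
    adClosure K e (Set.range e) ≤ Submodule.span K (⋃ k, positiveRootVectors K A h e k) := by
  refine adClosure_le ?_ fun i => ?_
  · rintro _ ⟨i, rfl⟩
    exact Submodule.subset_span
      (Set.mem_iUnion.mpr ⟨_, H.e_mem_weightSpace i, .inr ⟨i, rfl, rfl⟩⟩)
  · refine mem_adStabilizer_span fun x hx => ?_
    obtain ⟨k, hxk, hx⟩ := Set.mem_iUnion.mp hx
    have hmem := lie_mem_weightSpace (H.e_mem_weightSpace i) hxk
    rcases hx with hk | ⟨j, rfl, rfl⟩
    · exact Submodule.subset_span (Set.mem_iUnion.mpr ⟨_, hmem, .inl (hk.single_add i)⟩)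
    rcases eq_or_ne i j with rfl | hij
    · simp
    · exact Submodule.subset_span (Set.mem_iUnion.mpr
        ⟨_, hmem, .inl (isPositiveNonMultiple_single_add_single hij)⟩)

/-- A spanning set of the weight space of `k`, for every element `k` of the root lattice. -/
def rootVectors (K : Type*) [Field K] [LieAlgebra K L] (A : Matrix ι ι ℤ) (h e f : ι → L)
    (k : ι → ℤ) : Set L :=
  {x ∈ Set.range h | k = 0} ∪ positiveRootVectors K A h e k ∪ positiveRootVectors K A (-h) f (-k)

namespace ChevalleySystem

lemma iSup_span_rootVectors (H : ChevalleySystem K A h e f) :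
    ⨆ k, Submodule.span K (rootVectors K A h e f k) = ⊤ := by
  rw [← Submodule.span_iUnion, eq_top_iff, ← H.span_sup_adClosure_sup_adClosure]
  refine sup_le (sup_le ?_ (H.adClosure_le_span.trans ?_)) (H.symm.adClosure_le_span.trans ?_) <;>
    refine Submodule.span_mono ?_
  · exact fun x hx => Set.mem_iUnion.mpr ⟨0, .inl (.inl ⟨hx, rfl⟩)⟩
  · exact Set.iUnion_mono fun k x hx => .inl (.inr hx)
  · exact Set.iUnion_subset fun k x hx => Set.mem_iUnion.mpr ⟨-k, .inr (by rwa [neg_neg])⟩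

variable [CharZero K]

lemma span_rootVectors (H : ChevalleySystem K A h e f) (hA : Function.Injective A.mulVec)
    (k : ι → ℤ) : Submodule.span K (rootVectors K A h e f k) = weightSpace K A h k := by
  suffices (fun k => Submodule.span K (rootVectors K A h e f k)) ≤ weightSpace K A h from congrFun
    (((H.iSupIndep_weightSpace hA).le_iff_eq_of_iSup_eq_top H.iSup_span_rootVectors).mp this) k
  refine fun k => Submodule.span_le.mpr ?_
  rintro _ ((⟨⟨i, rfl⟩, rfl⟩ | hx) | hx)
  · exact H.h_mem_weightSpace i
  · exact hx.1
  · rw [SetLike.mem_coe, ← weightSpace_neg]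
    exact hx.1

lemma weightSpace_single (H : ChevalleySystem K A h e f) (hA : Function.Injective A.mulVec)
    (i : ι) : weightSpace K A h (Pi.single i 1) = K ∙ e i := by
  refine le_antisymm ?_ ((Submodule.span_singleton_le_iff_mem _ _).mpr (H.e_mem_weightSpace i))
  rw [← H.span_rootVectors hA, Submodule.span_le]
  rintro x ((⟨-, h0⟩ | ⟨-, hi | ⟨j, hij, rfl⟩⟩) | ⟨-, hi | ⟨j, hij, -⟩⟩)
  · simp at h0
  · exact absurd hi (not_isPositiveNonMultiple_single i)
  · obtain rfl : i = j := by
      by_contra hne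
      simpa [hne] using congrFun hij i
    exact Submodule.mem_span_singleton_self _
  · simpa using hi.1 i
  · have hji := congrFun hij j
    by_cases h : j = i <;> simp [h] at hji

lemma eq_zero_or_single_or_isPositiveNonMultiple (H : ChevalleySystem K A h e f)
    (hA : Function.Injective A.mulVec) (hk : weightSpace K A h k ≠ ⊥) :
    k = 0 ∨ ((∃ i, k = Pi.single i 1) ∨ IsPositiveNonMultiple k) ∨
      (∃ i, -k = Pi.single i 1) ∨ IsPositiveNonMultiple (-k) := by
  rw [← H.span_rootVectors hA, Ne, Submodule.span_eq_bot, not_forall₂] at hk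
  obtain ⟨x, (⟨-, h0⟩ | ⟨-, h⟩) | ⟨-, h⟩, -⟩ := hk
  · exact .inl h0
  · exact .inr (.inl (h.symm.imp_left fun ⟨i, hi, _⟩ => ⟨i, hi⟩))
  · exact .inr (.inr (h.symm.imp_left fun ⟨i, hi, _⟩ => ⟨i, hi⟩))

end ChevalleySystem

end WeightSpaces

section Reflection

lemma toEnd_pow_ne_zero_of_hasPrimitiveVectorWith {R L M : Type*} [CommRing R] [IsDomain R]
    [CharZero R] [LieRing L] [LieAlgebra R L] [AddCommGroup M] [Module R M]
    [Module.IsTorsionFree R M] [LieRingModule L M] [LieModule R L M] {h e f : L}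
    {t : IsSl2Triple h e f} {x : M} {μ : R} (P : t.HasPrimitiveVectorWith x μ) {N : ℕ}
    (hμ : ∀ n < N, μ ≠ n) : (LieModule.toEnd R L M f ^ N) x ≠ 0 := by
  induction N with
  | zero => exact P.ne_zero
  | succ N ih =>
    intro h0
    have hlie := P.lie_e_pow_succ_toEnd_f N
    rw [h0, lie_zero, eq_comm, smul_eq_zero] at hlie
    refine hlie.elim (mul_ne_zero (Nat.cast_add_one_ne_zero N) ?_)
      (ih fun n hn => hμ n (hn.trans N.lt_succ_self))
    exact sub_ne_zero.mpr (hμ N N.lt_succ_self)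

variable {ι L : Type*} [Fintype ι] [LieRing L] {K : Type*} [Field K] [LieAlgebra K L]
  {A : Matrix ι ι ℤ} {h e f : ι → L} {k : ι → ℤ} {x : L} {i : ι}

lemma ChevalleySystem.lie_f_ne_zero [CharZero K] (H : ChevalleySystem K A h e f) (hi : A i i = 2)
    (hx : x ∈ weightSpace K A h k) (hx0 : x ≠ 0) (hki : 0 < A.mulVec k i) : ⁅f i, x⁆ ≠ 0 := by
  intro hfx
  have P : (H.symm.isSl2Triple hi).HasPrimitiveVectorWith x (-(A.mulVec k i : ℤ) : K) :=
    ⟨hx0, by rw [Pi.neg_apply, neg_lie, mem_weightSpace.mp hx, neg_smul], hfx⟩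
  obtain ⟨N, hN⟩ := H.exists_ad_e_pow_eq_zero i x
  refine toEnd_pow_ne_zero_of_hasPrimitiveVectorWith P (fun n _ => ?_) hN
  exact_mod_cast (by omega : -A.mulVec k i ≠ n)

variable [DecidableEq ι]

/-- The action on the root lattice of the simple reflection at the root `α_i`. -/
def reflect (A : Matrix ι ι ℤ) (i : ι) (k : ι → ℤ) : ι → ℤ :=
  k - A.mulVec k i • Pi.single i 1

namespace ChevalleySystem

lemma exists_hasPrimitiveVectorWith (H : ChevalleySystem K A h e f) (hi : A i i = 2)
    (hk : weightSpace K A h k ≠ ⊥) :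
    ∃ r : ℕ, ∃ y ∈ weightSpace K A h (k + r • Pi.single i 1),
      (H.isSl2Triple hi).HasPrimitiveVectorWith y ((A.mulVec k i + 2 * r : ℤ) : K) := by
  obtain ⟨x, hx, hx0⟩ := Submodule.exists_mem_ne_zero_of_ne_bot hk
  obtain ⟨r, hr, hr'⟩ := Nat.exists_not_and_succ_of_not_zero_of_exists
    (p := fun n => (LieAlgebra.ad K L (e i) ^ n) x = 0) hx0 (H.exists_ad_e_pow_eq_zero i x)
  have hmem := ad_pow_mem_weightSpace (H.e_mem_weightSpace i) hx r
  refine ⟨r, _, hmem, hr, ?_, by rwa [pow_succ', Module.End.mul_apply] at hr'⟩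
  rw [mem_weightSpace.mp hmem i, Matrix.mulVec_add, Matrix.mulVec_smul, Pi.add_apply,
    Pi.smul_apply, Matrix.mulVec_single_one, Matrix.col_apply, hi, nsmul_eq_mul, mul_comm]

variable [CharZero K]

lemma weightSpace_reflect_ne_bot_of_nonneg (H : ChevalleySystem K A h e f) (hi : A i i = 2)
    (hki : 0 ≤ A.mulVec k i) (hk : weightSpace K A h k ≠ ⊥) :
    weightSpace K A h (reflect A i k) ≠ ⊥ := by
  obtain ⟨r, y, hy, P⟩ := H.exists_hasPrimitiveVectorWith hi hk
  obtain ⟨n, hn⟩ := Int.eq_ofNat_of_zero_le hki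
  have hne := toEnd_pow_ne_zero_of_hasPrimitiveVectorWith P (N := n + r) fun m hm => by
    rw [hn]
    exact_mod_cast (by omega : n + 2 * r ≠ m)
  have hweight : reflect A i k = k + r • Pi.single i 1 + (n + r) • -Pi.single i 1 := by
    rw [reflect, hn]
    module
  rw [hweight]
  exact (Submodule.ne_bot_iff _).mpr
    ⟨_, ad_pow_mem_weightSpace (H.f_mem_weightSpace i) hy (n + r), hne⟩

theorem weightSpace_reflect_ne_bot (H : ChevalleySystem K A h e f) (hi : A i i = 2)
    (hk : weightSpace K A h k ≠ ⊥) : weightSpace K A h (reflect A i k) ≠ ⊥ := by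
  rcases le_total 0 (A.mulVec k i) with hki | hki
  · exact H.weightSpace_reflect_ne_bot_of_nonneg hi hki hk
  · have hneg : -reflect A i k = reflect A i (-k) := by
      rw [reflect, reflect, Matrix.mulVec_neg, Pi.neg_apply]
      module
    rw [← weightSpace_neg] at hk ⊢
    rw [hneg]
    exact H.symm.weightSpace_reflect_ne_bot_of_nonneg hi (by simpa [Matrix.mulVec_neg]) hk

end ChevalleySystem

end Reflection

section NormBound

variable {ι : Type*} [Fintype ι]

lemma dotProduct_mulVec_comm {R : Type*} [CommSemiring R] {A : Matrix ι ι R} (hA : A.IsSymm)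
    (k l : ι → R) : k ⬝ᵥ A.mulVec l = l ⬝ᵥ A.mulVec k := by
  rw [Matrix.dotProduct_mulVec, ← Matrix.mulVec_transpose, hA.eq, dotProduct_comm]

lemma dotProduct_mulVec_add_self {R : Type*} [CommSemiring R] {A : Matrix ι ι R} (hA : A.IsSymm)
    (k l : ι → R) :
    (k + l) ⬝ᵥ A.mulVec (k + l) =
      k ⬝ᵥ A.mulVec k + 2 * (k ⬝ᵥ A.mulVec l) + l ⬝ᵥ A.mulVec l := by
  rw [Matrix.mulVec_add, add_dotProduct, dotProduct_add, dotProduct_add,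
    dotProduct_mulVec_comm hA l k]
  ring

variable [DecidableEq ι] {A : Matrix ι ι ℤ} {i : ι} {k l : ι → ℤ}

lemma reflect_apply_of_ne {j : ι} (hj : j ≠ i) : reflect A i k j = k j := by
  simp [reflect, hj]

lemma dotProduct_mulVec_reflect_self (hA : A.IsSymm) (hi : A i i = 2) (k : ι → ℤ) :
    reflect A i k ⬝ᵥ A.mulVec (reflect A i k) = k ⬝ᵥ A.mulVec k := by
  rw [reflect, sub_eq_add_neg, ← neg_smul, dotProduct_mulVec_add_self hA,
    dotProduct_mulVec_comm hA k (_ • _)]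
  simp only [Matrix.mulVec_smul, dotProduct_smul, smul_dotProduct, single_one_dotProduct,
    Matrix.mulVec_single_one, Matrix.col_apply, hi, smul_eq_mul]
  ring

lemma sum_reflect (A : Matrix ι ι ℤ) (i : ι) (k : ι → ℤ) :
    ∑ j, reflect A i k j = ∑ j, k j - A.mulVec k i := by
  simp [reflect, Finset.sum_sub_distrib, ← Finset.mul_sum]

variable {L : Type*} [LieRing L] {K : Type*} [Field K] [CharZero K] [LieAlgebra K L]
  {h e f : ι → L} {x y : L}

namespace ChevalleySystem

lemma eq_single_or_isPositiveNonMultiple_of_pos (H : ChevalleySystem K A h e f)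
    (hA : Function.Injective A.mulVec) (hk : weightSpace K A h k ≠ ⊥) (hki : 0 < k i) :
    (∃ j, k = Pi.single j 1) ∨ IsPositiveNonMultiple k := by
  rcases H.eq_zero_or_single_or_isPositiveNonMultiple hA hk with h0 | hpos | hneg
  · simp [h0] at hki
  · exact hpos
  · have hle : 0 ≤ -k := by
      obtain ⟨j, hj⟩ | hneg := hneg
      exacts [hj ▸ Pi.single_nonneg.mpr zero_le_one, hneg.1]
    exact absurd (hle i) (by simpa using hki)

lemma dotProduct_mulVec_self_le_two_of_nonneg (H : ChevalleySystem K A h e f)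
    (hdiag : ∀ i, A i i = 2) (hsymm : A.IsSymm) (hA : Function.Injective A.mulVec)
    (hk : weightSpace K A h k ≠ ⊥)
    (hpos : (∃ i, k = Pi.single i 1) ∨ IsPositiveNonMultiple k) :
    k ⬝ᵥ A.mulVec k ≤ 2 := by
  induction hn : (∑ j, k j).toNat using Nat.strong_induction_on generalizing k with
  | _ n ih =>
    obtain ⟨i, rfl⟩ | ⟨hk0, a, b, hab, ha, hb⟩ := hpos
    · simp [hdiag]
    by_cases hle : ∀ i, A.mulVec k i ≤ 0
    · exact (Finset.sum_nonpos fun i _ =>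
        mul_nonpos_of_nonneg_of_nonpos (hk0 i) (hle i)).trans zero_le_two
    push Not at hle
    obtain ⟨i, hi⟩ := hle
    obtain ⟨j, hji, hj⟩ : ∃ j, j ≠ i ∧ 0 < k j := by
      rcases eq_or_ne a i with rfl | hai
      exacts [⟨b, hab.symm, hb⟩, ⟨a, hai, ha⟩]
    rw [← dotProduct_mulVec_reflect_self hsymm (hdiag i)]
    have hk' := H.weightSpace_reflect_ne_bot (hdiag i) hk
    refine ih _ ?_ hk' (H.eq_single_or_isPositiveNonMultiple_of_pos hA hk'
      (by rwa [reflect_apply_of_ne hji])) rfl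
    have hsum : 0 < ∑ j, k j := Finset.sum_pos' (fun i _ => hk0 i) ⟨j, Finset.mem_univ j, hj⟩
    rw [sum_reflect]
    omega

omit [DecidableEq ι] in
theorem dotProduct_mulVec_self_le_two (H : ChevalleySystem K A h e f)
    (hdiag : ∀ i, A i i = 2) (hsymm : A.IsSymm) (hA : Function.Injective A.mulVec)
    (hk : weightSpace K A h k ≠ ⊥) : k ⬝ᵥ A.mulVec k ≤ 2 := by
  classical
  rcases H.eq_zero_or_single_or_isPositiveNonMultiple hA hk with rfl | hpos | hneg
  · simp
  · exact H.dotProduct_mulVec_self_le_two_of_nonneg hdiag hsymm hA hk hpos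
  · rw [← weightSpace_neg] at hk
    simpa [Matrix.mulVec_neg] using
      H.symm.dotProduct_mulVec_self_le_two_of_nonneg hdiag hsymm hA hk hneg

omit [DecidableEq ι] in
theorem lie_lie_eq_zero (H : ChevalleySystem K A h e f) (hdiag : ∀ i, A i i = 2)
    (hsymm : A.IsSymm) (hA : Function.Injective A.mulVec) (hx : x ∈ weightSpace K A h k)
    (hy : y ∈ weightSpace K A h l) (hk : k ⬝ᵥ A.mulVec k = 2) (hl : l ⬝ᵥ A.mulVec l = 2)
    (hkl : -1 ≤ k ⬝ᵥ A.mulVec l) : ⁅x, ⁅x, y⁆⁆ = 0 := by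
  have hmem := lie_mem_weightSpace hx (lie_mem_weightSpace hx hy)
  by_contra hne
  have hle := H.dotProduct_mulVec_self_le_two hdiag hsymm hA
    ((Submodule.ne_bot_iff _).mpr ⟨_, hmem, hne⟩)
  rw [dotProduct_mulVec_add_self hsymm, dotProduct_mulVec_add_self hsymm, Matrix.mulVec_add,
    dotProduct_add, hk, hl] at hle
  omega

end ChevalleySystem

end NormBound

end KacMoody

namespace QMSA

variable {K L : Type*} [Field K] [LieRing L] [LieAlgebra K L] {n m : ℕ}

lemma exists_lieHom {μ : Fin n → K} (v : Fin n → L)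
    (hv : ∀ j, FreeLieAlgebra.lift K v (relator K n m μ j) = 0) :
    ∃ φ : QMSA K n m μ →ₗ⁅K⁆ L, ∀ i, φ (x K n m μ i) = v i := by
  have hle : QMSA.ideal K n m μ ≤ (FreeLieAlgebra.lift K v).ker := by
    refine LieSubmodule.lieSpan_le.mpr ?_
    rintro _ ⟨j, rfl⟩
    exact LieHom.mem_ker.mpr (hv j)
  let φ : QMSA K n m μ →ₗ[K] L := (QMSA.ideal K n m μ).toSubmodule.liftQ
    (FreeLieAlgebra.lift K v : FreeLieAlgebra K (Fin n) →ₗ[K] L)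
    fun y hy => LieHom.mem_ker.mp (hle hy)
  refine ⟨{ φ with map_lie' := fun {a b} => ?_ }, fun i => FreeLieAlgebra.lift_of_apply v i⟩
  obtain ⟨a, rfl⟩ := LieSubmodule.Quotient.surjective_mk' _ a
  obtain ⟨b, rfl⟩ := LieSubmodule.Quotient.surjective_mk' _ b
  exact LieHom.map_lie (FreeLieAlgebra.lift K v) a b

variable {v : Fin n → L}

lemma lift_relator_zero (hv : ∀ i j, ⁅v i, ⁅v i, v j⁆⁆ = 0) (j : Fin n) :
    FreeLieAlgebra.lift K v (relator K n m (fun _ => 0) j) = 0 := by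
  rw [relator, zero_smul, sub_zero, map_sum]
  simp only [map_smul, LieHom.map_lie, FreeLieAlgebra.lift_of_apply, hv, smul_zero,
    Finset.sum_const_zero]

theorem exists_surjective_lieHom (m : ℕ) (hv : ∀ i j, ⁅v i, ⁅v i, v j⁆⁆ = 0)
    (hspan : LieSubalgebra.lieSpan K L (Set.range v) = ⊤) :
    ∃ φ : QMSA K n m (fun _ => 0) →ₗ⁅K⁆ L,
      (∀ i, φ (x K n m (fun _ => 0) i) = v i) ∧ Function.Surjective φ := by
  obtain ⟨φ, hφ⟩ := exists_lieHom (K := K) (m := m) v (lift_relator_zero hv)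
  refine ⟨φ, hφ, ?_⟩
  rw [← LieHom.range_eq_top, eq_top_iff, ← hspan, LieSubalgebra.lieSpan_le]
  rintro _ ⟨i, rfl⟩
  exact ⟨_, hφ i⟩

end QMSA

namespace E10

open KacMoody

lemma isSymm_cartan : cartan.IsSymm := by
  decide

lemma isGCM_cartan : IsGCM cartan where
  diag := by decide
  nonpos {i j} := (by decide : ∀ i j, i ≠ j → Matrix.of.symm cartan i j ≤ 0) i j
  zero_symm {i j} h := (isSymm_cartan.apply i j).trans h

/-- The inverse of the Cartan matrix of type `E₁₀`, which is unimodular. -/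
def cartanInv : Matrix (Fin 10) (Fin 10) ℤ :=
  !![ 0,  -1,  -2,  -3,  -4,  -5,  -6,  -4,  -2,  -3;
     -1,  -2,  -4,  -6,  -8, -10, -12,  -8,  -4,  -6;
     -2,  -4,  -6,  -9, -12, -15, -18, -12,  -6,  -9;
     -3,  -6,  -9, -12, -16, -20, -24, -16,  -8, -12;
     -4,  -8, -12, -16, -20, -25, -30, -20, -10, -15;
     -5, -10, -15, -20, -25, -30, -36, -24, -12, -18;
     -6, -12, -18, -24, -30, -36, -42, -28, -14, -21;
     -4,  -8, -12, -16, -20, -24, -28, -18,  -9, -14;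
     -2,  -4,  -6,  -8, -10, -12, -14,  -9,  -4,  -7;
     -3,  -6,  -9, -12, -15, -18, -21, -14,  -7, -10]

lemma cartanInv_mul_cartan : cartanInv * cartan = 1 := by
  decide +kernel

lemma mulVec_cartan_injective : Function.Injective cartan.mulVec :=
  Function.LeftInverse.injective (g := cartanInv.mulVec) fun k => by
    rw [Matrix.mulVec_mulVec, cartanInv_mul_cartan, Matrix.one_mulVec]

/-- The weights of the 26 elements: the `f_i` have weight `-α_i`, the other ones lie in the root
spaces of the 16 roots. -/
def weight : Fin 26 → Fin 10 → ℤ :=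
  (Fin.append (fun i => -Pi.single i 1) roots : Fin (10 + 16) → Fin 10 → ℤ)

lemma weight_injective : Function.Injective weight := by
  decide +kernel

lemma dotProduct_mulVec_weight_self (i : Fin 26) :
    weight i ⬝ᵥ cartan.mulVec (weight i) = 2 := by
  revert i
  decide +kernel

lemma neg_one_le_dotProduct_mulVec_weight (i j : Fin 26) :
    -1 ≤ weight i ⬝ᵥ cartan.mulVec (weight j) := by
  revert i j
  decide +kernel

lemma roots_ne_zero (k : Fin 16) : roots k ≠ 0 := by
  revert k
  decide +kernel

lemma exists_roots_eq_reflect (k : Fin 16) :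
    ∃ i j l, roots k = reflect cartan l (reflect cartan j (Pi.single i 1)) := by
  revert k
  decide +kernel

lemma exists_roots_eq_add (i : Fin 10) :
    ∃ k j, roots k = Pi.single j 1 + Pi.single i 1 ∧ 0 < cartan.mulVec (roots k) j := by
  revert i
  decide +kernel

variable {K : Type*} [Field K]

lemma rootSpace_eq_weightSpace (k : Fin 10 → ℤ) :
    rootSpace K cartan k = weightSpace K cartan (h K cartan) k := by
  ext x
  rw [mem_weightSpace]
  rfl

variable {e : Fin 16 → LieAlg K}

lemma chi_mem_weightSpace (he : ∀ k, e k ∈ rootSpace K cartan (roots k)) (i : Fin 26) :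
    chi K e i ∈ weightSpace K cartan (h K cartan) (weight i) := by
  refine Fin.addCases (m := 10) (n := 16) (motive := fun i =>
    chi K e i ∈ weightSpace K cartan (h K cartan) (weight i)) (fun i => ?_) (fun k => ?_) i
  · rw [chi, weight, Fin.append_left, Fin.append_left]
    exact (chevalleySystem K isGCM_cartan).f_mem_weightSpace i
  · rw [chi, weight, Fin.append_right, Fin.append_right, ← rootSpace_eq_weightSpace]
    exact he k

lemma chi_ne_zero (he : ∀ k, e k ≠ 0) (i : Fin 26) : chi K e i ≠ 0 := by
  refine Fin.addCases (m := 10) (n := 16) (motive := fun i => chi K e i ≠ 0) (fun i => ?_)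
    (fun k => ?_) i
  · rw [chi, Fin.append_left]
    exact (chevalleySystem K isGCM_cartan).symm.e_ne_zero i
  · rw [chi, Fin.append_right]
    exact he k

variable [CharZero K]

theorem isRoot_roots (k : Fin 16) : IsRoot K cartan (roots k) := by
  refine ⟨roots_ne_zero k, ?_⟩
  have H := chevalleySystem K isGCM_cartan
  obtain ⟨i, j, l, hk⟩ := exists_roots_eq_reflect k
  rw [rootSpace_eq_weightSpace, hk]
  refine H.weightSpace_reflect_ne_bot (isGCM_cartan.diag l)
    (H.weightSpace_reflect_ne_bot (isGCM_cartan.diag j) ?_)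
  exact (Submodule.ne_bot_iff _).mpr ⟨_, H.e_mem_weightSpace i, H.e_ne_zero i⟩

theorem lieSpan_chi_eq_top (he : ∀ k, e k ∈ rootSpace K cartan (roots k)) (he0 : ∀ k, e k ≠ 0) :
    LieSubalgebra.lieSpan K (LieAlg K) (Set.range (chi K e)) = ⊤ := by
  have H := chevalleySystem K isGCM_cartan
  set S := LieSubalgebra.lieSpan K (LieAlg K) (Set.range (chi K e))
  have hf (i) : f K cartan i ∈ S :=
    LieSubalgebra.subset_lieSpan ⟨Fin.castAdd 16 i, Fin.append_left _ _ i⟩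
  have heS (k) : e k ∈ S :=
    LieSubalgebra.subset_lieSpan ⟨Fin.natAdd 10 k, Fin.append_right _ _ k⟩
  rw [eq_top_iff, ← H.lieSpan_eq_top, LieSubalgebra.lieSpan_le]
  refine Set.union_subset (Set.range_subset_iff.mpr fun i => ?_) (Set.range_subset_iff.mpr hf)
  obtain ⟨k, j, hk, hkj⟩ := exists_roots_eq_add i
  have hek : e k ∈ weightSpace K cartan (h K cartan) (roots k) :=
    rootSpace_eq_weightSpace (K := K) (roots k) ▸ he k
  have hmem := lie_mem_weightSpace (H.f_mem_weightSpace j) hek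
  rw [hk, neg_add_cancel_left, H.weightSpace_single mulVec_cartan_injective] at hmem
  obtain ⟨c, hc⟩ := Submodule.mem_span_singleton.mp hmem
  have hc0 : c ≠ 0 := by
    rintro rfl
    exact H.lie_f_ne_zero (isGCM_cartan.diag j) hek (he0 k) hkj (by rw [← hc, zero_smul])
  rw [SetLike.mem_coe, ← inv_smul_smul₀ hc0 (KacMoody.e K cartan i), hc]
  exact S.smul_mem _ (S.lie_mem (hf j) (heS k))

theorem lie_chi_lie_chi (he : ∀ k, e k ∈ rootSpace K cartan (roots k)) (i j : Fin 26) :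
    ⁅chi K e i, ⁅chi K e i, chi K e j⁆⁆ = 0 :=
  (chevalleySystem K isGCM_cartan).lie_lie_eq_zero isGCM_cartan.diag isSymm_cartan
    mulVec_cartan_injective (chi_mem_weightSpace he i) (chi_mem_weightSpace he j)
    (dotProduct_mulVec_weight_self i) (dotProduct_mulVec_weight_self j)
    (neg_one_le_dotProduct_mulVec_weight i j)

theorem linearIndependent_chi (he : ∀ k, e k ∈ rootSpace K cartan (roots k))
    (he0 : ∀ k, e k ≠ 0) : LinearIndependent K (chi K e) :=
  (((chevalleySystem K isGCM_cartan).iSupIndep_weightSpace mulVec_cartan_injective).comp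
    weight_injective).linearIndependent _ (chi_mem_weightSpace he) (chi_ne_zero he0)

end E10

theorem mainTheorem6_general (K : Type*) [Field K] [CharZero K] :
    (∀ k : Fin 16, KacMoody.IsRoot K E10.cartan (E10.roots k)) ∧
    ∀ e : Fin 16 → E10.LieAlg K,
      (∀ k, e k ∈ KacMoody.rootSpace K E10.cartan (E10.roots k) ∧ e k ≠ 0) →
      LieSubalgebra.lieSpan K (E10.LieAlg K) (Set.range (E10.chi K e)) = ⊤ ∧
      (∀ i j : Fin 26, ⁅E10.chi K e i, ⁅E10.chi K e i, E10.chi K e j⁆⁆ = 0) ∧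
      LinearIndependent K (E10.chi K e) ∧
      ∀ m : ℕ, m ≤ 26 →
        ∃ φ : QMSA K 26 m (fun _ => 0) →ₗ⁅K⁆ E10.LieAlg K,
          (∀ i, φ (QMSA.x K 26 m (fun _ => 0) i) = E10.chi K e i) ∧
          Function.Surjective φ := by
  refine ⟨E10.isRoot_roots, fun e he => ?_⟩
  have hmem k := (he k).1
  have hne k := (he k).2
  have hspan := E10.lieSpan_chi_eq_top hmem hne
  have hlie := E10.lie_chi_lie_chi hmem
  exact ⟨hspan, hlie, E10.linearIndependent_chi hmem hne,
    fun m _ => QMSA.exists_surjective_lieHom m hlie hspan⟩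

theorem mainTheorem6 (K : Type*) [RCLike K] :
    (∀ k : Fin 16, KacMoody.IsRoot K E10.cartan (E10.roots k)) ∧
    ∀ e : Fin 16 → E10.LieAlg K,
      (∀ k, e k ∈ KacMoody.rootSpace K E10.cartan (E10.roots k) ∧ e k ≠ 0) →
      LieSubalgebra.lieSpan K (E10.LieAlg K) (Set.range (E10.chi K e)) = ⊤ ∧
      (∀ i j : Fin 26, ⁅E10.chi K e i, ⁅E10.chi K e i, E10.chi K e j⁆⁆ = 0) ∧
      LinearIndependent K (E10.chi K e) ∧
      ∀ m : ℕ, m ≤ 26 →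
        ∃ φ : QMSA K 26 m (fun _ => 0) →ₗ⁅K⁆ E10.LieAlg K,
          (∀ i, φ (QMSA.x K 26 m (fun _ => 0) i) = E10.chi K e i) ∧
          Function.Surjective φ := by
  exact mainTheorem6_general K
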